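/- Let $\mathcal S^n$ be the space of real symmetric $n\times n$ matrices with the trace inner product $\langle X,Y\rangle=\operatorname{tr}(XY)$ and the Frobenius norm, let $\mathcal S^n_+$ be the cone of positive semidefinite matrices, and let $\Pi_{\mathcal S^n_+}$ be the metric projector onto it. Let $\mathcal Q:\mathcal S^n\to\mathcal S^n$ be a self-adjoint positive semidefinite linear operator, $\mathcal A:\mathcal S^n\to\mathbb R^m$ a linear map with adjoint $\mathcal A^*$, $b\in\mathbb R^m$, $C,\widehat X\in\mathcal S^n$, $\sigma>0$, and $\widehat C:=C-\sigma^{-1}\widehat X$. Let $(\overline W,\bar y)$ be an optimal solution of $$\min\Big\{\varphi(W,y):=\tfrac12\langle W,\mathcal QW\rangle-\langle b,y\rangle+\tfrac{\sigma}{2}\big\|\Pi_{\mathcal S^n_+}(\mathcal A^*y-\mathcal QW-\widehat C)\big\|^2\ :\ (W,y)\in\operatorname{Range}(\mathcal Q)\times\mathbb R^m\Big\},$$ and let $\overline Y:=\Pi_{\mathcal S^n_+}(\mathcal A^*\bar y-\mathcal Q\overline W-\widehat C)$. Then the following two conditions are equivalent. (i) The constraint nondegeneracy condition $\mathcal A\,\mathrm{lin}(\mathcal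 T_{\mathcal S^n_+}(\overline Y))=\mathbb R^m$ holds, where $\mathrm{lin}(\mathcal T_{\mathcal S^n_+}(\overline Y))=\mathcal T_{\mathcal S^n_+}(\overline Y)\cap(-\mathcal T_{\mathcal S^n_+}(\overline Y))$ is the lineality space of the tangent cone of $\mathcal S^n_+$ at $\overline Y$. (ii) Every element of $$\begin{bmatrix}\mathcal Q&\\&0\end{bmatrix}+\sigma\begin{bmatrix}\mathcal Q\\-\mathcal A\end{bmatrix}\partial\Pi_{\mathcal S^n_+}(\mathcal A^*\bar y-\mathcal Q\overline W-\widehat C)\,[\mathcal Q\ \ -\mathcal A^*]$$ is self-adjoint and positive definite as an operator on $\operatorname{Range}(\mathcal Q)\times\mathbb R^m$. Here $\partial\Pi_{\mathcal S^n_+}$ denotes the Clarke subdifferential (generalized Jacobian) of $\Pi_{\mathcal S^n_+}$: the convex hull of all limits of derivatives $\Pi_{\mathcal S^n_+}'(X_k)$ along sequences of points of differentiability $X_k$ converging to the given point. -/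

import Mathlib

open Filter Topology

namespace QSDP

noncomputable section

/-! ### The Euclidean space of symmetric matrices with the trace inner product -/

/-- The symmetric real `n × n` matrices, as a subspace of all matrices. -/
def symmSubmodule (n : ℕ) : Submodule ℝ (Matrix (Fin n) (Fin n) ℝ) where
  carrier := {X | X.IsSymm}
  zero_mem' := Matrix.isSymm_zero
  add_mem' hX hY := hX.add hY
  smul_mem' c _ hX := hX.smul c

theorem trace_mul_self_of_isSymm {n : ℕ} {X : Matrix (Fin n) (Fin n) ℝ} (hX : X.IsSymm) :
    (X * X).trace = ∑ i, ∑ j, X i j ^ 2 := by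
  simp only [Matrix.trace, Matrix.diag_apply, Matrix.mul_apply]
  refine Finset.sum_congr rfl fun i _ => Finset.sum_congr rfl fun j _ => ?_
  rw [hX.apply i j, sq]

/-- The trace inner product `⟨X, Y⟩ = tr (X Y)` of symmetric matrices. -/
@[reducible] def traceInnerCore (n : ℕ) : InnerProductSpace.Core ℝ (symmSubmodule n) where
  inner X Y := ((X : Matrix (Fin n) (Fin n) ℝ) * (Y : Matrix (Fin n) (Fin n) ℝ)).trace
  conj_inner_symm X Y := by
    simp only [conj_trivial]
    exact Matrix.trace_mul_comm _ _
  re_inner_nonneg X := by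
    rw [trace_mul_self_of_isSymm X.2, RCLike.re_to_real]
    positivity
  add_left X Y Z := by simp only [Submodule.coe_add, add_mul, Matrix.trace_add]
  smul_left X Y c := by
    simp only [Submodule.coe_smul, smul_mul_assoc, Matrix.trace_smul, smul_eq_mul, conj_trivial]
  definite X h := by
    rw [trace_mul_self_of_isSymm X.2] at h
    ext i j
    have h1 := (Finset.sum_eq_zero_iff_of_nonneg (fun i _ => Finset.sum_nonneg fun j _ =>
      sq_nonneg ((X : Matrix (Fin n) (Fin n) ℝ) i j))).1 h i (Finset.mem_univ i)
    have h2 := (Finset.sum_eq_zero_iff_of_nonneg (fun j _ =>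
      sq_nonneg ((X : Matrix (Fin n) (Fin n) ℝ) i j))).1 h1 j (Finset.mem_univ j)
    simpa using h2

/-- The space `𝒮ⁿ` of symmetric real `n × n` matrices. It is a separate type so that its norm
and topology are the ones of the trace inner product. -/
def SymMat (n : ℕ) : Type := symmSubmodule n

namespace SymMat

variable {n : ℕ}

instance : NormedAddCommGroup (SymMat n) :=
  @InnerProductSpace.Core.toNormedAddCommGroup ℝ (symmSubmodule n) _ _ _ (traceInnerCore n)

instance : InnerProductSpace ℝ (SymMat n) :=
  @InnerProductSpace.ofCore ℝ (symmSubmodule n) _ _ _ (traceInnerCore n).toCore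

instance : FiniteDimensional ℝ (SymMat n) :=
  inferInstanceAs (FiniteDimensional ℝ (symmSubmodule n))

instance : CompleteSpace (SymMat n) := FiniteDimensional.complete ℝ (SymMat n)

/-- The inclusion of `𝒮ⁿ` into the space of all matrices. -/
def toMatrix : SymMat n →ₗ[ℝ] Matrix (Fin n) (Fin n) ℝ := (symmSubmodule n).subtype

theorem toMatrix_isSymm (X : SymMat n) : (toMatrix X).IsSymm := X.2

theorem inner_def (X Y : SymMat n) : inner ℝ X Y = (toMatrix X * toMatrix Y).trace := rfl

end SymMat

/-- The cone `𝒮ⁿ₊` of positive semidefinite matrices. -/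
def psdCone (n : ℕ) : Set (SymMat n) := {X | (SymMat.toMatrix X).PosSemidef}

/-! ### Metric projector, Clarke subdifferential, lineality space -/

section General

variable {E F : Type*} [NormedAddCommGroup E] [NormedSpace ℝ E]
  [NormedAddCommGroup F] [NormedSpace ℝ F]

/-- `y` is a point of `D` nearest to `x`. -/
def IsNearest (D : Set E) (x y : E) : Prop := y ∈ D ∧ ∀ z ∈ D, ‖x - y‖ ≤ ‖x - z‖

/-- The metric projector `Π_D`: the point of `D` nearest to `x`. It is used only for the closed
convex cone `𝒮ⁿ₊`, where this point exists and is unique (`existsUnique_isNearest_psdCone`). -/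
def metricProj (D : Set E) (x : E) : E := Classical.epsilon (IsNearest D x)

/-- The B-subdifferential of `f` at `x`: all limits of derivatives of `f` along sequences of points
of differentiability that converge to `x`. -/
def bSubdifferential (f : E → F) (x : E) : Set (E →L[ℝ] F) :=
  {V | ∃ u : ℕ → E, (∀ k, DifferentiableAt ℝ f (u k)) ∧ Tendsto u atTop (𝓝 x) ∧
    Tendsto (fun k => fderiv ℝ f (u k)) atTop (𝓝 V)}

/-- The Clarke subdifferential (generalized Jacobian) of a locally Lipschitz map between
finite-dimensional spaces: the convex hull of the B-subdifferential. -/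
def clarkeSubdifferential (f : E → F) (x : E) : Set (E →L[ℝ] F) :=
  convexHull ℝ (bSubdifferential f x)

/-- The lineality space `T ∩ (-T)` of a convex cone `T`. -/
def linealitySpace (T : Set E) : Set E := {H | H ∈ T ∧ -H ∈ T}

end General

section PsdProjection

variable {n : ℕ}

theorem mem_psdCone {X : SymMat n} :
    X ∈ psdCone n ↔ ∀ v : Fin n → ℝ, 0 ≤ v ⬝ᵥ (SymMat.toMatrix X).mulVec v := by
  constructor
  · intro h v
    simpa using h.dotProduct_mulVec_nonneg v
  · intro h
    refine Matrix.PosSemidef.of_dotProduct_mulVec_nonneg ?_ fun v => by simpa using h v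
    have := SymMat.toMatrix_isSymm X
    rwa [Matrix.IsHermitian, Matrix.conjTranspose_eq_transpose_of_trivial]

/-- The linear functional `X ↦ vᵀ X v`. -/
def quadFunctional (v : Fin n → ℝ) : SymMat n →ₗ[ℝ] ℝ where
  toFun X := v ⬝ᵥ (SymMat.toMatrix X).mulVec v
  map_add' X Y := by simp [Matrix.add_mulVec]
  map_smul' c X := by simp [Matrix.smul_mulVec]

theorem psdCone_eq : psdCone n = ⋂ v : Fin n → ℝ, {X | 0 ≤ quadFunctional v X} := by
  ext X
  simp only [mem_psdCone, Set.mem_iInter, Set.mem_ofPred_eq]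
  rfl

theorem isClosed_psdCone : IsClosed (psdCone n) := by
  rw [psdCone_eq]
  exact isClosed_iInter fun v =>
    isClosed_le continuous_const (quadFunctional v).continuous_of_finiteDimensional

theorem convex_psdCone : Convex ℝ (psdCone n) := by
  rw [psdCone_eq]
  exact convex_iInter fun v => convex_halfSpace_ge (quadFunctional v).isLinear 0

theorem existsUnique_isNearest_psdCone (X : SymMat n) : ∃! Y, IsNearest (psdCone n) X Y := by
  have hne : (psdCone n).Nonempty := ⟨0, by simp [mem_psdCone]⟩
  have key : ∀ Y ∈ psdCone n, IsNearest (psdCone n) X Y →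
      ∀ w ∈ psdCone n, inner ℝ (X - Y) (w - Y) ≤ 0 := by
    intro Y hY hmin
    refine (norm_eq_iInf_iff_real_inner_le_zero convex_psdCone hY).1 ?_
    have : Nonempty (psdCone n) := ⟨⟨Y, hY⟩⟩
    refine le_antisymm (le_ciInf fun w => hmin.2 w w.2) (ciInf_le ⟨0, ?_⟩ (⟨Y, hY⟩ : psdCone n))
    rintro _ ⟨w, rfl⟩
    exact norm_nonneg _
  obtain ⟨Y, hY, hYd⟩ := isClosed_psdCone.exists_infDist_eq_dist hne X
  have hYn : IsNearest (psdCone n) X Y := by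
    refine ⟨hY, fun z hz => ?_⟩
    rw [← dist_eq_norm, ← dist_eq_norm, ← hYd]
    exact Metric.infDist_le_dist_of_mem hz
  refine ⟨Y, hYn, fun Z hZ => ?_⟩
  have h1 := key Y hY hYn Z hZ.1
  have h2 := key Z hZ.1 hZ Y hY
  have h3 : inner ℝ (Z - Y) (Z - Y) = inner ℝ (X - Y) (Z - Y) + inner ℝ (X - Z) (Y - Z) := by
    rw [← neg_sub Z Y, inner_neg_right, ← sub_eq_add_neg, ← inner_sub_left]
    congr 1
    abel
  have h4 : inner ℝ (Z - Y) (Z - Y) ≤ 0 := by rw [h3]; linarith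
  rw [real_inner_self_eq_norm_sq] at h4
  exact sub_eq_zero.1 (norm_eq_zero.1 (by nlinarith [norm_nonneg (Z - Y)]))

end PsdProjection

/-- The projector `Π_{𝒮ⁿ₊}`. -/
def projPsd (n : ℕ) : SymMat n → SymMat n := metricProj (psdCone n)

theorem isNearest_projPsd {n : ℕ} (X : SymMat n) : IsNearest (psdCone n) X (projPsd n X) :=
  Classical.epsilon_spec (existsUnique_isNearest_psdCone X).exists

/-! ### The inner problem and the generalized Hessian -/

section InnerProblem

variable {n m : ℕ}

/-- The Euclidean space `Range(Q) × ℝᵐ`. -/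
abbrev VarSpace (m : ℕ) (Q : SymMat n →L[ℝ] SymMat n) : Type :=
  WithLp 2 (Q.toLinearMap.range × EuclideanSpace ℝ (Fin m))

/-- `S(W, y) = A* y - Q W - Ĉ`. -/
def slack (Q : SymMat n →L[ℝ] SymMat n) (A : SymMat n →L[ℝ] EuclideanSpace ℝ (Fin m))
    (Chat : SymMat n) (z : VarSpace m Q) : SymMat n :=
  A.adjoint z.snd - Q z.fst - Chat

/-- `φ(W, y) = ½⟨W, Q W⟩ - ⟨b, y⟩ + (σ/2) ‖Π_{𝒮ⁿ₊}(S(W, y))‖²`. -/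
def phi (Q : SymMat n →L[ℝ] SymMat n) (A : SymMat n →L[ℝ] EuclideanSpace ℝ (Fin m))
    (b : EuclideanSpace ℝ (Fin m)) (Chat : SymMat n) (σ : ℝ) (z : VarSpace m Q) : ℝ :=
  1 / 2 * inner ℝ (z.fst : SymMat n) (Q z.fst) - inner ℝ b z.snd
    + σ / 2 * ‖projPsd n (slack Q A Chat z)‖ ^ 2

/-- The block operator `Diag(Q, 0)` on `Range(Q) × ℝᵐ`: `(dW, dy) ↦ (Q dW, 0)`. -/
def diagOp (m : ℕ) (Q : SymMat n →L[ℝ] SymMat n) : VarSpace m Q →ₗ[ℝ] VarSpace m Q where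
  toFun d := WithLp.toLp 2 (Q.toLinearMap.rangeRestrict d.fst, 0)
  map_add' d e := by
    apply (WithLp.equiv 2 _).injective
    ext1 <;> simp
  map_smul' c d := by
    apply (WithLp.equiv 2 _).injective
    ext1 <;> simp

/-- The block row `[Q, -A*]` on `Range(Q) × ℝᵐ`: `(dW, dy) ↦ Q dW - A* dy`. -/
def rowOp (Q : SymMat n →L[ℝ] SymMat n) (A : SymMat n →L[ℝ] EuclideanSpace ℝ (Fin m)) :
    VarSpace m Q →ₗ[ℝ] SymMat n where
  toFun d := Q d.fst - A.adjoint d.snd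
  map_add' d e := by simp only [WithLp.add_fst, WithLp.add_snd, Submodule.coe_add, map_add]; abel
  map_smul' c d := by simp [smul_sub]

/-- The block column `[Q; -A]` with values in `Range(Q) × ℝᵐ`: `H ↦ (Q H, -A H)`. -/
def colOp (Q : SymMat n →L[ℝ] SymMat n) (A : SymMat n →L[ℝ] EuclideanSpace ℝ (Fin m)) :
    SymMat n →ₗ[ℝ] VarSpace m Q where
  toFun H := WithLp.toLp 2 (Q.toLinearMap.rangeRestrict H, -A H)
  map_add' H K := by
    apply (WithLp.equiv 2 _).injective
    ext1
    · simp
    · simp [add_comm]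
  map_smul' c H := by
    apply (WithLp.equiv 2 _).injective
    ext1 <;> simp

/-- The operator `Diag(Q, 0) + σ [Q; -A] U [Q, -A*]` on `Range(Q) × ℝᵐ`. -/
def hessOp (Q : SymMat n →L[ℝ] SymMat n) (A : SymMat n →L[ℝ] EuclideanSpace ℝ (Fin m))
    (σ : ℝ) (U : SymMat n →L[ℝ] SymMat n) : VarSpace m Q →ₗ[ℝ] VarSpace m Q :=
  diagOp m Q + σ • (colOp Q A ∘ₗ U.toLinearMap ∘ₗ rowOp Q A)

/-- The set `Diag(Q, 0) + σ [Q; -A] ∂Π_{𝒮ⁿ₊}(S(W, y)) [Q, -A*]` of operators on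
`Range(Q) × ℝᵐ`. -/
def genHessian (Q : SymMat n →L[ℝ] SymMat n) (A : SymMat n →L[ℝ] EuclideanSpace ℝ (Fin m))
    (Chat : SymMat n) (σ : ℝ) (z : VarSpace m Q) : Set (VarSpace m Q →ₗ[ℝ] VarSpace m Q) :=
  hessOp Q A σ '' clarkeSubdifferential (projPsd n) (slack Q A Chat z)

end InnerProblem

end

end QSDP

/-!
Write `S` for the slack matrix, `Π` for the projector onto `𝒮ⁿ₊` and `Y = Π(S)`. Both conditions are
equivalent to the following one: `Y (A* y) = 0` implies `y = 0`. Optimality of the point at which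
`S` is formed plays no role in this.

*Nondegeneracy* (`image_linealitySpace_eq_univ_iff`). The orthogonal complement of the lineality
space of the tangent cone at `Y` is `{M | Y M = 0}`. Such an `M` is orthogonal to the lineality
space because its positive and negative parts are supporting functionals of `𝒮ⁿ₊` at `Y`. Conversely
the lineality space contains the range of the self-adjoint operator `B ↦ Y B + B Y`, whose kernel is
contained in `{M | Y M = 0}`.

*Positive definiteness.* The quadratic form of the operator given by `U ∈ ∂Π(S)` at `(W, y)` is
`⟨W, Q W⟩ + σ ⟨R, U R⟩` with `R = Q W - A* y`. As `U` is symmetric and positive semidefinite and `Q`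
is positive definite on its range, the form can vanish only if `W = 0` and `⟨A* y, U A* y⟩ = 0`.
Hence it has to be seen that `⟨H, U H⟩ = 0` implies `Y H = 0` for every `U ∈ ∂Π(S)`
(`clarkeSubdifferential_projPsd`), and that some `U` vanishes on all `H` with `Y H = 0`
(`exists_mem_bSubdifferential_projPsd`).

No formula for the derivative of `Π` is needed. Derivatives of `Π` are symmetric because `Π` is a
gradient, and satisfy `‖U H‖² ≤ ⟨H, U H⟩` because `Π` is firmly nonexpansive. Differentiating
`Π(X) (X - Π(X)) = 0` gives `D (X - Π(X)) + Π(X) (H - D) = 0` for `D = U H`, and this identity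
passes to limits. If `D = 0`, it says `Π(X) H = 0`, which is the first claim. If `Π(X) H = 0` and
`X` is invertible, it forces `D = 0`. For the second claim let `E` be positive semidefinite with
`Y E = 0` and `Y + E` invertible, such as the orthogonal projector onto the kernel of `Y`: then
`S - ε E` is invertible with `Π(S - ε E) = Y` for `ε > 0`, the B-subdifferential there is nonempty by
Rademacher's theorem, and its elements accumulate at some `U ∈ ∂Π(S)` as `ε → 0`.
-/

namespace QSDP

/-! ### Traces of products of positive semidefinite matrices -/

section Matrix

variable {n : ℕ} {A B : Matrix (Fin n) (Fin n) ℝ}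

open scoped MatrixOrder in
theorem exists_eq_transpose_mul_self (hA : A.PosSemidef) :
    ∃ R : Matrix (Fin n) (Fin n) ℝ, A = R.transpose * R := by
  obtain ⟨R, hR⟩ := CStarAlgebra.nonneg_iff_eq_star_mul_self.1 hA.nonneg
  exact ⟨R, by rw [hR, Matrix.star_eq_conjTranspose, Matrix.conjTranspose_eq_transpose_of_trivial]⟩

theorem trace_mul_eq_trace_transpose_mul_self (R S : Matrix (Fin n) (Fin n) ℝ) :
    (R.transpose * R * (S.transpose * S)).trace =
      ((R * S.transpose).transpose * (R * S.transpose)).trace := by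
  rw [Matrix.transpose_mul, Matrix.transpose_transpose, ← Matrix.mul_assoc, Matrix.trace_mul_comm]
  simp only [Matrix.mul_assoc]

theorem trace_mul_nonneg (hA : A.PosSemidef) (hB : B.PosSemidef) : 0 ≤ (A * B).trace := by
  obtain ⟨R, rfl⟩ := exists_eq_transpose_mul_self hA
  obtain ⟨S, rfl⟩ := exists_eq_transpose_mul_self hB
  rw [trace_mul_eq_trace_transpose_mul_self, ← Matrix.conjTranspose_eq_transpose_of_trivial]
  exact (Matrix.posSemidef_conjTranspose_mul_self _).trace_nonneg

theorem eq_zero_of_transpose_mul_self_trace {R : Matrix (Fin n) (Fin n) ℝ}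
    (h : (R.transpose * R).trace = 0) : R = 0 := by
  rwa [← Matrix.conjTranspose_eq_transpose_of_trivial,
    Matrix.trace_conjTranspose_mul_self_eq_zero_iff] at h

/-- Complementary positive semidefinite matrices annihilate each other. -/
theorem mul_eq_zero_of_trace_mul_eq_zero (hA : A.PosSemidef) (hB : B.PosSemidef)
    (h : (A * B).trace = 0) : A * B = 0 := by
  obtain ⟨R, rfl⟩ := exists_eq_transpose_mul_self hA
  obtain ⟨S, rfl⟩ := exists_eq_transpose_mul_self hB
  rw [trace_mul_eq_trace_transpose_mul_self] at h
  rw [Matrix.mul_assoc, ← Matrix.mul_assoc R, eq_zero_of_transpose_mul_self_trace h,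
    Matrix.zero_mul, Matrix.mul_zero]

/-- For positive semidefinite `A`, the trace of `Bᵀ A B` is a squared seminorm of `B` whose kernel
is `{B | A B = 0}`. -/
theorem mul_eq_zero_of_trace_conj_eq_zero (hA : A.PosSemidef)
    (h : (B.transpose * A * B).trace = 0) : A * B = 0 := by
  obtain ⟨R, rfl⟩ := exists_eq_transpose_mul_self hA
  have h' : ((R * B).transpose * (R * B)).trace = 0 := by
    rw [← h, Matrix.transpose_mul]
    simp only [Matrix.mul_assoc]
  rw [Matrix.mul_assoc, eq_zero_of_transpose_mul_self_trace h', Matrix.mul_zero]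

theorem trace_conj_nonneg (hA : A.PosSemidef) : 0 ≤ (B.transpose * A * B).trace := by
  have := hA.conjTranspose_mul_mul_same B
  rw [Matrix.conjTranspose_eq_transpose_of_trivial] at this
  exact this.trace_nonneg

/-- A positive semidefinite matrix `A` has a positive semidefinite complement `E`, such as the
orthogonal projector onto its kernel: `A E = 0` and `A + E` is invertible. -/
theorem exists_posSemidef_complement (hA : A.PosSemidef) :
    ∃ E : Matrix (Fin n) (Fin n) ℝ, E.PosSemidef ∧ A * E = 0 ∧ IsUnit (A + E) := by
  let U : Matrix (Fin n) (Fin n) ℝ := (hA.1.eigenvectorUnitary).val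
  set d := hA.1.eigenvalues
  let e : Fin n → ℝ := fun i => if d i = 0 then 1 else 0
  have hUU : star U * U = 1 := Unitary.coe_star_mul_self hA.1.eigenvectorUnitary
  have hUU' : U * star U = 1 := Unitary.coe_mul_star_self hA.1.eigenvectorUnitary
  have hAd : A = U * Matrix.diagonal d * star U := by
    have := hA.1.spectral_theorem
    rw [Unitary.conjStarAlgAut_apply] at this
    exact this
  have hd0 : ∀ i, 0 ≤ d i := hA.eigenvalues_nonneg
  refine ⟨U * Matrix.diagonal e * star U, ?_, ?_, ?_⟩
  · refine Matrix.PosSemidef.mul_mul_conjTranspose_same (Matrix.PosSemidef.diagonal fun i => ?_) U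
    simp only [e, Pi.zero_apply]
    split_ifs <;> norm_num
  · have hde : Matrix.diagonal d * Matrix.diagonal e = 0 := by
      rw [Matrix.diagonal_mul_diagonal, ← Matrix.diagonal_zero]
      congr 1
      funext i
      by_cases h : d i = 0 <;> simp [e, h]
    calc A * (U * Matrix.diagonal e * star U)
        = U * Matrix.diagonal d * (star U * U) * Matrix.diagonal e * star U := by
          rw [hAd]; simp only [Matrix.mul_assoc]
      _ = 0 := by rw [hUU, Matrix.mul_one, Matrix.mul_assoc U, hde]; simp
  · have hsum : A + U * Matrix.diagonal e * star U = U * Matrix.diagonal (d + e) * star U := by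
      conv_lhs => rw [hAd]
      rw [← Matrix.add_mul, ← Matrix.mul_add, Matrix.diagonal_add]; rfl
    rw [hsum]
    have hUu : IsUnit U := IsUnit.of_mul_eq_one _ hUU'
    have hUs : IsUnit (star U) := IsUnit.of_mul_eq_one _ hUU
    refine (hUu.mul (Matrix.isUnit_diagonal.2 (Pi.isUnit_iff.2 fun i =>
      isUnit_iff_ne_zero.2 ?_))).mul hUs
    by_cases h : d i = 0 <;> simp [e, h]

end Matrix

/-! ### Projectors onto convex sets and their derivatives -/

section Projector

variable {E : Type*} [NormedAddCommGroup E] [InnerProductSpace ℝ E] {D : Set E} {p : E → E}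

theorem IsNearest.inner_sub_le_zero (hD : Convex ℝ D) {x y w : E} (h : IsNearest D x y)
    (hw : w ∈ D) : inner ℝ (x - y) (w - y) ≤ 0 := by
  refine (norm_eq_iInf_iff_real_inner_le_zero hD h.1).1 ?_ w hw
  have : Nonempty D := ⟨⟨y, h.1⟩⟩
  refine le_antisymm (le_ciInf fun w => h.2 w w.2) (ciInf_le ⟨0, ?_⟩ (⟨y, h.1⟩ : D))
  rintro _ ⟨w, rfl⟩
  exact norm_nonneg _

/-- The projector onto a convex set is firmly nonexpansive. -/
theorem norm_sq_sub_le_inner_of_isNearest (hD : Convex ℝ D) (hp : ∀ x, IsNearest D x (p x))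
    (x y : E) : ‖p x - p y‖ ^ 2 ≤ inner ℝ (x - y) (p x - p y) := by
  have h1 := (hp x).inner_sub_le_zero hD (hp y).1
  have h2 := (hp y).inner_sub_le_zero hD (hp x).1
  have h3 : inner ℝ (x - y) (p x - p y) - inner ℝ (p x - p y) (p x - p y)
      = - inner ℝ (x - p x) (p y - p x) - inner ℝ (y - p y) (p x - p y) := by
    rw [← neg_sub (p x) (p y), inner_neg_right, neg_neg, ← inner_sub_left, ← inner_sub_left]
    congr 1
    abel
  rw [← real_inner_self_eq_norm_sq]
  linarith

theorem lipschitzWith_one_of_isNearest (hD : Convex ℝ D) (hp : ∀ x, IsNearest D x (p x)) :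
    LipschitzWith 1 p := by
  refine LipschitzWith.of_dist_le_mul fun x y => ?_
  rw [dist_eq_norm, dist_eq_norm, NNReal.coe_one, one_mul]
  have h1 := norm_sq_sub_le_inner_of_isNearest hD hp x y
  have h2 := real_inner_le_norm (x - y) (p x - p y)
  by_contra! h
  nlinarith [norm_nonneg (x - y)]

/-- The projector `p` onto a convex set `D` is the gradient of
`x ↦ ⟨x, p x⟩ - ½ ‖p x‖² = max_{z ∈ D} (⟨x, z⟩ - ½ ‖z‖²)`. -/
theorem hasFDerivAt_potential_of_isNearest (hD : Convex ℝ D) (hp : ∀ x, IsNearest D x (p x))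
    (x : E) : HasFDerivAt (fun x => inner ℝ x (p x) - 1 / 2 * ‖p x‖ ^ 2) (innerSL ℝ (p x)) x := by
  set θ : E → ℝ := fun x => inner ℝ x (p x) - 1 / 2 * ‖p x‖ ^ 2 with hθ
  -- `p x` maximizes `⟨x, z⟩ - ½ ‖z‖²` over `z ∈ D`, as it minimizes `‖x - z‖²`.
  have hmax : ∀ x, ∀ z ∈ D, inner ℝ x z - 1 / 2 * ‖z‖ ^ 2 ≤ θ x := by
    intro x z hz
    have h := pow_le_pow_left₀ (norm_nonneg _) ((hp x).2 z hz) 2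
    rw [norm_sub_sq_real, norm_sub_sq_real] at h
    simp only [hθ]
    linarith
  have hle : ∀ y, ‖θ y - θ x - innerSL ℝ (p x) (y - x)‖ ≤ ‖y - x‖ ^ 2 := by
    intro y
    have h1 := hmax y (p x) (hp x).1
    have h2 := hmax x (p y) (hp y).1
    have h3 := norm_sq_sub_le_inner_of_isNearest hD hp y x
    have h4 := real_inner_le_norm (y - x) (p y - p x)
    have h5 : ‖p y - p x‖ ≤ ‖y - x‖ := by
      simpa [dist_eq_norm] using (lipschitzWith_one_of_isNearest hD hp).dist_le_mul y x
    have h6 : ‖y - x‖ * ‖p y - p x‖ ≤ ‖y - x‖ ^ 2 := by nlinarith [norm_nonneg (y - x)]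
    rw [innerSL_apply_apply, real_inner_comm, Real.norm_eq_abs, abs_le]
    simp only [hθ, inner_sub_left, inner_sub_right] at *
    constructor <;> nlinarith [sq_nonneg ‖y - x‖]
  rw [hasFDerivAt_iff_isLittleO]
  refine Asymptotics.IsBigO.trans_isLittleO (g := fun y => ‖y - x‖ ^ 2)
    (Asymptotics.IsBigO.of_bound 1 (Eventually.of_forall fun y => ?_)) ?_
  · rw [one_mul, Real.norm_of_nonneg (sq_nonneg ‖y - x‖)]
    exact hle y
  · exact (Asymptotics.isLittleO_norm_pow_id one_lt_two).comp_tendsto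
      (tendsto_sub_nhds_zero_iff.2 tendsto_id)

/-- Derivatives of the projector onto a convex set are symmetric, being second derivatives. -/
theorem inner_fderiv_comm_of_isNearest (hD : Convex ℝ D) (hp : ∀ x, IsNearest D x (p x))
    {x : E} (hx : DifferentiableAt ℝ p x) (v w : E) :
    inner ℝ (fderiv ℝ p x v) w = inner ℝ v (fderiv ℝ p x w) := by
  have h := second_derivative_symmetric (𝕜 := ℝ)
    (hasFDerivAt_potential_of_isNearest hD hp)
    ((innerSL ℝ (E := E)).hasFDerivAt.comp x hx.hasFDerivAt) v w
  exact h.trans (real_inner_comm _ _)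

/-- Firm nonexpansiveness passes to derivatives; in particular these are positive semidefinite and
their quadratic form vanishes only on their kernel. -/
theorem norm_sq_fderiv_le_inner_of_isNearest (hD : Convex ℝ D) (hp : ∀ x, IsNearest D x (p x))
    {x : E} (hx : DifferentiableAt ℝ p x) (v : E) :
    ‖fderiv ℝ p x v‖ ^ 2 ≤ inner ℝ v (fderiv ℝ p x v) := by
  have hlim : Tendsto (fun t : ℝ => t⁻¹ • (p (x + t • v) - p x)) (𝓝[≠] 0)
      (𝓝 (fderiv ℝ p x v)) := by
    have h := (hx.hasFDerivAt.hasLineDerivAt v)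
    exact h.tendsto_slope_zero
  refine le_of_tendsto_of_tendsto (hlim.norm.pow 2) (tendsto_const_nhds.inner hlim)
    (eventually_nhdsWithin_of_forall fun t ht => ?_)
  have h := norm_sq_sub_le_inner_of_isNearest hD hp (x + t • v) x
  have ht' : t ≠ 0 := ht
  rw [add_sub_cancel_left, real_inner_smul_left] at h
  simp only [norm_smul, mul_pow, real_inner_smul_right, norm_inv, Real.norm_eq_abs, inv_pow, sq_abs]
  calc (t ^ 2)⁻¹ * ‖p (x + t • v) - p x‖ ^ 2
      ≤ (t ^ 2)⁻¹ * (t * inner ℝ v (p (x + t • v) - p x)) := by gcongr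
    _ = t⁻¹ * inner ℝ v (p (x + t • v) - p x) := by field_simp

end Projector

/-! ### The B-subdifferential of a Lipschitz map -/

section BSubdifferential

variable {E F : Type*} [NormedAddCommGroup E] [NormedSpace ℝ E]
  [NormedAddCommGroup F] [NormedSpace ℝ F] {f : E → F} {x : E}

/-- The graph of the B-subdifferential is the closure of the graph of the derivative. -/
theorem mem_bSubdifferential_iff_mem_closure {V : E →L[ℝ] F} :
    V ∈ bSubdifferential f x ↔
      (x, V) ∈ closure ((fun u => (u, fderiv ℝ f u)) '' {u | DifferentiableAt ℝ f u}) := by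
  rw [mem_closure_iff_seq_limit]
  constructor
  · rintro ⟨u, hu, hux, huV⟩
    exact ⟨fun k => (u k, fderiv ℝ f (u k)), fun k => ⟨u k, hu k, rfl⟩, hux.prodMk_nhds huV⟩
  · rintro ⟨s, hs, hlim⟩
    choose u hu hus using hs
    have h1 := (continuous_fst.tendsto _).comp hlim
    have h2 := (continuous_snd.tendsto _).comp hlim
    refine ⟨u, hu, h1.congr fun k => ?_, h2.congr fun k => ?_⟩ <;>
      simp [← hus k]

theorem mem_bSubdifferential_of_tendsto {s : ℕ → E} {V : ℕ → E →L[ℝ] F} {W : E →L[ℝ] F}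
    (hV : ∀ k, V k ∈ bSubdifferential f (s k)) (hs : Tendsto s atTop (𝓝 x))
    (hW : Tendsto V atTop (𝓝 W)) : W ∈ bSubdifferential f x := by
  simp only [mem_bSubdifferential_iff_mem_closure] at hV ⊢
  exact isClosed_closure.mem_of_tendsto (hs.prodMk_nhds hW) (Eventually.of_forall hV)

theorem norm_le_of_mem_bSubdifferential {K : NNReal} (hf : LipschitzWith K f) {V : E →L[ℝ] F}
    (hV : V ∈ bSubdifferential f x) : ‖V‖ ≤ K := by
  obtain ⟨u, -, -, h⟩ := hV
  exact le_of_tendsto h.norm (Eventually.of_forall fun k => norm_fderiv_le_of_lipschitz ℝ hf)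

variable [FiniteDimensional ℝ E] [FiniteDimensional ℝ F]

/-- By Rademacher's theorem, points of differentiability of a Lipschitz map are dense. -/
theorem dense_differentiableAt_of_lipschitzWith {K : NNReal} (hf : LipschitzWith K f) :
    Dense {u | DifferentiableAt ℝ f u} :=
  let _ : MeasurableSpace E := borel E
  have _ : BorelSpace E := ⟨rfl⟩
  let w := Module.Basis.ofVectorSpace ℝ E
  MeasureTheory.Measure.dense_of_ae (hf.ae_differentiableAt (μ := w.addHaar))

/-- Derivatives of a Lipschitz map are bounded by its constant, so that they accumulate along any
sequence of points of differentiability. -/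
theorem nonempty_bSubdifferential {K : NNReal} (hf : LipschitzWith K f) (x : E) :
    (bSubdifferential f x).Nonempty := by
  obtain ⟨u, hu, hux⟩ := mem_closure_iff_seq_limit.1 (dense_differentiableAt_of_lipschitzWith hf x)
  have : ProperSpace (E →L[ℝ] F) := FiniteDimensional.proper ℝ _
  obtain ⟨V, -, φ, hφ, hV⟩ := (isCompact_closedBall (0 : E →L[ℝ] F) K).tendsto_subseq
    (x := fun k => fderiv ℝ f (u k)) fun k => by
      simpa using norm_fderiv_le_of_lipschitz ℝ hf
  exact ⟨V, u ∘ φ, fun k => hu _, hux.comp hφ.tendsto_atTop, hV⟩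

end BSubdifferential

/-! ### The projector onto the positive semidefinite cone -/

section PsdProjector

variable {n : ℕ}

open SymMat

/-- A symmetric matrix as an element of `𝒮ⁿ`. -/
def SymMat.ofIsSymm (M : Matrix (Fin n) (Fin n) ℝ) (hM : M.IsSymm) : SymMat n := ⟨M, hM⟩

@[simp]
theorem SymMat.toMatrix_ofIsSymm (M : Matrix (Fin n) (Fin n) ℝ) (hM : M.IsSymm) :
    toMatrix (SymMat.ofIsSymm M hM) = M := rfl

theorem SymMat.toMatrix_injective : Function.Injective (toMatrix (n := n)) :=
  Subtype.coe_injective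

@[simp]
theorem SymMat.transpose_toMatrix (X : SymMat n) : (toMatrix X).transpose = toMatrix X :=
  toMatrix_isSymm X

theorem SymMat.mul_eq_zero_comm {X Y : SymMat n} :
    toMatrix X * toMatrix Y = 0 ↔ toMatrix Y * toMatrix X = 0 := by
  rw [← Matrix.transpose_eq_zero, Matrix.transpose_mul, transpose_toMatrix, transpose_toMatrix]

theorem isSymm_of_posSemidef {B : Matrix (Fin n) (Fin n) ℝ} (hB : B.PosSemidef) : B.IsSymm := by
  have := hB.1
  rwa [Matrix.IsHermitian, Matrix.conjTranspose_eq_transpose_of_trivial] at this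

theorem projPsd_posSemidef (X : SymMat n) : (toMatrix (projPsd n X)).PosSemidef :=
  (isNearest_projPsd X).1

theorem projPsd_eq_of_isNearest {X Y : SymMat n} (h : IsNearest (psdCone n) X Y) :
    projPsd n X = Y :=
  (existsUnique_isNearest_psdCone X).unique (isNearest_projPsd X) h

theorem inner_sub_projPsd_self (X : SymMat n) :
    inner ℝ (X - projPsd n X) (projPsd n X) = 0 := by
  have hX := isNearest_projPsd X
  have hzero : (0 : SymMat n) ∈ psdCone n := by simp [mem_psdCone]
  have htwo : projPsd n X + projPsd n X ∈ psdCone n := by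
    rw [psdCone, Set.mem_ofPred_eq, map_add]
    exact hX.1.add hX.1
  have h1 := hX.inner_sub_le_zero convex_psdCone hzero
  have h2 := hX.inner_sub_le_zero convex_psdCone htwo
  rw [zero_sub, inner_neg_right] at h1
  rw [add_sub_cancel_right] at h2
  linarith

/-- The negative part of a symmetric matrix is positive semidefinite. -/
theorem projPsd_sub_posSemidef (X : SymMat n) : (toMatrix (projPsd n X - X)).PosSemidef := by
  change projPsd n X - X ∈ psdCone n
  rw [mem_psdCone]
  intro v
  let w : SymMat n := SymMat.ofIsSymm (Matrix.vecMulVec v v) (Matrix.transpose_vecMulVec v v)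
  have hw : w ∈ psdCone n := by
    change (Matrix.vecMulVec v v).PosSemidef
    simpa using Matrix.posSemidef_vecMulVec_self_star v
  have h1 := (isNearest_projPsd X).inner_sub_le_zero convex_psdCone hw
  rw [inner_sub_right, inner_sub_projPsd_self, sub_zero, ← neg_sub, inner_neg_left, inner_def,
    show toMatrix w = Matrix.vecMulVec v v from rfl, Matrix.mul_vecMulVec,
    Matrix.trace_vecMulVec, dotProduct_comm] at h1
  linarith

theorem projPsd_mul_sub (X : SymMat n) :
    toMatrix (projPsd n X) * toMatrix (X - projPsd n X) = 0 := by
  have h := inner_sub_projPsd_self X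
  rw [real_inner_comm, ← neg_sub, inner_neg_right, neg_eq_zero, inner_def] at h
  rw [← neg_sub, map_neg, Matrix.mul_neg,
    mul_eq_zero_of_trace_mul_eq_zero (projPsd_posSemidef X) (projPsd_sub_posSemidef X) h, neg_zero]

/-- A splitting of `X` as a difference of complementary positive semidefinite matrices determines
the projection of `X`. -/
theorem projPsd_eq {X Y : SymMat n} (hY : (toMatrix Y).PosSemidef)
    (hN : (toMatrix (Y - X)).PosSemidef) (h : toMatrix Y * toMatrix (Y - X) = 0) :
    projPsd n X = Y := by
  refine projPsd_eq_of_isNearest ⟨hY, fun w hw => ?_⟩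
  have h1 : 0 ≤ inner ℝ (Y - X) w := trace_mul_nonneg hN hw
  have h2 : inner ℝ (Y - X) Y = 0 := by
    rw [real_inner_comm, inner_def, h, Matrix.trace_zero]
  have h3 : ‖X - w‖ ^ 2 = ‖X - Y‖ ^ 2 + 2 * inner ℝ (Y - X) w + ‖Y - w‖ ^ 2 := by
    have : X - w = (X - Y) + (Y - w) := by abel
    rw [this, norm_add_sq_real, ← neg_sub Y X, inner_neg_left, inner_sub_right, h2]
    ring
  refine (sq_le_sq₀ (norm_nonneg _) (norm_nonneg _)).1 ?_
  nlinarith [sq_nonneg ‖Y - w‖]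

theorem lipschitzWith_projPsd : LipschitzWith 1 (projPsd n) :=
  lipschitzWith_one_of_isNearest convex_psdCone isNearest_projPsd

theorem continuous_toMatrix : Continuous (toMatrix (n := n)) :=
  toMatrix.continuous_of_finiteDimensional

open scoped Matrix.Norms.Operator in
/-- Differentiating `Π(X) (X - Π(X)) = 0` at `X`, where `D` is the derivative of `Π` in the
direction `H`, gives `D (X - Π(X)) + Π(X) (H - D) = 0`. -/
theorem fderiv_projPsd_mul {X : SymMat n} (hX : DifferentiableAt ℝ (projPsd n) X) (H : SymMat n) :
    toMatrix (fderiv ℝ (projPsd n) X H) * toMatrix (X - projPsd n X) +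
      toMatrix (projPsd n X) * toMatrix (H - fderiv ℝ (projPsd n) X H) = 0 := by
  let T : SymMat n →L[ℝ] Matrix (Fin n) (Fin n) ℝ := ⟨toMatrix, continuous_toMatrix⟩
  have h1 : HasFDerivAt (fun X => T (projPsd n X)) (T ∘L fderiv ℝ (projPsd n) X) X :=
    T.hasFDerivAt.comp X hX.hasFDerivAt
  have h2 : HasFDerivAt (fun X => T (X - projPsd n X))
      (T ∘L (ContinuousLinearMap.id ℝ _ - fderiv ℝ (projPsd n) X)) X :=
    T.hasFDerivAt.comp X ((hasFDerivAt_id X).sub hX.hasFDerivAt)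
  have h3 := h1.mul' h2
  have h4 : (fun X => T (projPsd n X) * T (X - projPsd n X)) = fun _ => 0 :=
    funext projPsd_mul_sub
  have h5 := h3.unique (h4 ▸ hasFDerivAt_const 0 X)
  have h6 := DFunLike.congr_fun h5 H
  rw [add_comm]
  exact h6

/-- An identity for the elements of the B-subdifferential of `Π` at `X`: the one obtained by
differentiating `Π(X) (X - Π(X)) = 0` passes to limits. -/
theorem bSubdifferential_projPsd_mul {X : SymMat n} {U : SymMat n →L[ℝ] SymMat n}
    (hU : U ∈ bSubdifferential (projPsd n) X) (H : SymMat n) :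
    toMatrix (U H) * toMatrix (X - projPsd n X) + toMatrix (projPsd n X) * toMatrix (H - U H)
      = 0 := by
  obtain ⟨u, hu, hux, huU⟩ := hU
  have hp : Tendsto (fun k => projPsd n (u k)) atTop (𝓝 (projPsd n X)) :=
    (lipschitzWith_projPsd.continuous.tendsto X).comp hux
  have hd : Tendsto (fun k => fderiv ℝ (projPsd n) (u k) H) atTop (𝓝 (U H)) :=
    ((ContinuousLinearMap.apply ℝ (SymMat n) H).continuous.tendsto U).comp huU
  have hT : ∀ {v : ℕ → SymMat n} {V : SymMat n}, Tendsto v atTop (𝓝 V) →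
      Tendsto (fun k => toMatrix (v k)) atTop (𝓝 (toMatrix V)) :=
    fun {_ V} h => (continuous_toMatrix.tendsto V).comp h
  refine tendsto_nhds_unique (((hT hd).mul (hT (hux.sub hp))).add
    ((hT hp).mul (hT (hd.const_sub H)))) ?_
  simp only [fderiv_projPsd_mul (hu _), tendsto_const_nhds]

theorem bSubdifferential_projPsd_inner_comm {X : SymMat n} {U : SymMat n →L[ℝ] SymMat n}
    (hU : U ∈ bSubdifferential (projPsd n) X) (H K : SymMat n) :
    inner ℝ (U H) K = inner ℝ H (U K) := by
  obtain ⟨u, hu, -, huU⟩ := hU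
  have hd : ∀ H, Tendsto (fun k => fderiv ℝ (projPsd n) (u k) H) atTop (𝓝 (U H)) :=
    fun H => ((ContinuousLinearMap.apply ℝ (SymMat n) H).continuous.tendsto U).comp huU
  refine tendsto_nhds_unique ((hd H).inner tendsto_const_nhds)
    ((tendsto_const_nhds.inner (hd K)).congr fun k => ?_)
  exact (inner_fderiv_comm_of_isNearest convex_psdCone isNearest_projPsd (hu k) H K).symm

theorem norm_sq_le_inner_of_mem_bSubdifferential {X : SymMat n} {U : SymMat n →L[ℝ] SymMat n}
    (hU : U ∈ bSubdifferential (projPsd n) X) (H : SymMat n) :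
    ‖U H‖ ^ 2 ≤ inner ℝ H (U H) := by
  obtain ⟨u, hu, -, huU⟩ := hU
  have hd : Tendsto (fun k => fderiv ℝ (projPsd n) (u k) H) atTop (𝓝 (U H)) :=
    ((ContinuousLinearMap.apply ℝ (SymMat n) H).continuous.tendsto U).comp huU
  exact le_of_tendsto_of_tendsto' (hd.norm.pow 2) (tendsto_const_nhds.inner hd) fun k =>
    norm_sq_fderiv_le_inner_of_isNearest convex_psdCone isNearest_projPsd (hu k) H

/-- Every element of the Clarke subdifferential of `Π` at `X` is symmetric and positive
semidefinite, and its quadratic form vanishes only at `H` with `Π(X) H = 0`. -/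
theorem clarkeSubdifferential_projPsd {X : SymMat n} {U : SymMat n →L[ℝ] SymMat n}
    (hU : U ∈ clarkeSubdifferential (projPsd n) X) :
    (∀ H K, inner ℝ (U H) K = inner ℝ H (U K)) ∧ (∀ H, 0 ≤ inner ℝ H (U H)) ∧
      ∀ H, inner ℝ H (U H) = 0 → toMatrix (projPsd n X) * toMatrix H = 0 := by
  have hconv : Convex ℝ {U : SymMat n →L[ℝ] SymMat n |
      (∀ H K, inner ℝ (U H) K = inner ℝ H (U K)) ∧ (∀ H, 0 ≤ inner ℝ H (U H)) ∧
      ∀ H, inner ℝ H (U H) = 0 → toMatrix (projPsd n X) * toMatrix H = 0} := by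
    rintro U ⟨hU1, hU2, hU3⟩ V ⟨hV1, hV2, hV3⟩ s t hs ht hst
    refine ⟨fun H K => ?_, fun H => ?_, fun H h => ?_⟩
    · simp [inner_add_left, inner_add_right, real_inner_smul_left, real_inner_smul_right, hU1, hV1]
    · have := mul_nonneg hs (hU2 H)
      have := mul_nonneg ht (hV2 H)
      simp only [add_apply, smul_apply, inner_add_right, real_inner_smul_right]
      positivity
    · simp only [add_apply, smul_apply, inner_add_right, real_inner_smul_right] at h
      have h1 := mul_nonneg hs (hU2 H)
      have h2 := mul_nonneg ht (hV2 H)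
      rcases hs.eq_or_lt with rfl | hs'
      · obtain rfl : t = 1 := by linarith
        exact hV3 H (by linarith)
      · exact hU3 H ((mul_eq_zero.1 (by linarith : s * inner ℝ H (U H) = 0)).resolve_left hs'.ne')
  refine convexHull_min (fun U hU => ?_) hconv hU
  have hle := norm_sq_le_inner_of_mem_bSubdifferential hU
  refine ⟨bSubdifferential_projPsd_inner_comm hU, fun H => (sq_nonneg _).trans (hle H),
    fun H h => ?_⟩
  have hzero : U H = 0 := norm_eq_zero.1 (pow_eq_zero_iff two_ne_zero |>.1
    (le_antisymm (h ▸ hle H) (sq_nonneg _)))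
  simpa [hzero] using bSubdifferential_projPsd_mul hU H

/-- Let `Y = Π(X)` and `N = Y - X`. If no nonzero `D` satisfies `Y D = 0` and `N D = 0`, that is, if
`X` is invertible, then every element of the B-subdifferential of `Π` at `X` vanishes on the `H`
with `Y H = 0`. -/
theorem apply_eq_zero_of_mem_bSubdifferential {X : SymMat n} {U : SymMat n →L[ℝ] SymMat n}
    (hU : U ∈ bSubdifferential (projPsd n) X)
    (hX : ∀ D : SymMat n, toMatrix (projPsd n X) * toMatrix D = 0 →
      toMatrix (projPsd n X - X) * toMatrix D = 0 → D = 0)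
    {H : SymMat n} (hH : toMatrix (projPsd n X) * toMatrix H = 0) : U H = 0 := by
  have h := bSubdifferential_projPsd_mul hU H
  set Y := projPsd n X
  set D := U H
  -- As `Y H = 0`, the differentiated identity reads `Y D + D (Y - X) = 0` up to sign; the trace of
  -- its product with `D` is a sum of two nonnegative terms.
  have h1 : toMatrix Y * toMatrix D + toMatrix D * toMatrix (Y - X) = 0 := by
    rw [map_sub _ H D, Matrix.mul_sub, hH, zero_sub, ← neg_sub Y X, map_neg, Matrix.mul_neg] at h
    rw [← neg_eq_zero, ← h]
    abel
  have h2 : ((toMatrix D).transpose * toMatrix Y * toMatrix D).trace +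
      ((toMatrix D).transpose * toMatrix (Y - X) * toMatrix D).trace = 0 := by
    rw [transpose_toMatrix, Matrix.trace_mul_comm (toMatrix D * toMatrix (Y - X)),
      Matrix.mul_assoc, ← Matrix.trace_add, ← Matrix.mul_add, h1, Matrix.mul_zero,
      Matrix.trace_zero]
  have h3 := trace_conj_nonneg (B := toMatrix D) (projPsd_posSemidef X)
  have h4 := trace_conj_nonneg (B := toMatrix D) (projPsd_sub_posSemidef X)
  exact hX D (mul_eq_zero_of_trace_conj_eq_zero (projPsd_posSemidef X) (by linarith))
    (mul_eq_zero_of_trace_conj_eq_zero (projPsd_sub_posSemidef X) (by linarith))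

/-- Some element of the B-subdifferential of `Π` at `X` vanishes on all `H` with `Π(X) H = 0`. -/
theorem exists_mem_bSubdifferential_projPsd (X : SymMat n) :
    ∃ U ∈ bSubdifferential (projPsd n) X,
      ∀ H, toMatrix (projPsd n X) * toMatrix H = 0 → U H = 0 := by
  set Y := projPsd n X
  obtain ⟨M, hM, hYM, hunit⟩ := exists_posSemidef_complement (projPsd_posSemidef X)
  let E := SymMat.ofIsSymm M (isSymm_of_posSemidef hM)
  have hE : (toMatrix E).PosSemidef := hM
  -- Moving from `X` to `X - ε E` does not change the projection, and adds a multiple of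
  -- `E` to its negative part, which makes `X - ε E` invertible.
  have hneg : ∀ ε : ℝ, Y - (X - ε • E) = (Y - X) + ε • E := fun ε => by abel
  have hproj : ∀ ε : ℝ, 0 < ε → projPsd n (X - ε • E) = Y := by
    intro ε hε
    refine projPsd_eq (projPsd_posSemidef X) ?_ ?_
    · rw [hneg, map_add, map_smul]
      exact (projPsd_sub_posSemidef X).add (hE.smul hε.le)
    · have h1 : toMatrix Y * toMatrix (Y - X) = 0 := by
        rw [← neg_sub, map_neg, Matrix.mul_neg, projPsd_mul_sub, neg_zero]
      have h2 : toMatrix Y * toMatrix E = 0 := hYM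
      rw [hneg, map_add, map_smul, Matrix.mul_add, Matrix.mul_smul, h1, h2, smul_zero, add_zero]
  have hkill : ∀ ε : ℝ, 0 < ε → ∀ U ∈ bSubdifferential (projPsd n) (X - ε • E),
      ∀ H, toMatrix Y * toMatrix H = 0 → U H = 0 := by
    intro ε hε U hU H hH
    refine apply_eq_zero_of_mem_bSubdifferential hU ?_ (by rwa [hproj ε hε])
    rw [hproj ε hε]
    intro D hYD hD
    rw [hneg, map_add, map_smul] at hD
    have h2 : ((toMatrix D).transpose * toMatrix (Y - X) * toMatrix D).trace +
        ε * ((toMatrix D).transpose * toMatrix E * toMatrix D).trace = 0 := by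
      have h := congrArg (fun N => ((toMatrix D).transpose * N).trace) hD
      simpa [Matrix.add_mul, Matrix.mul_add, Matrix.mul_assoc] using h
    have h3 := trace_conj_nonneg (B := toMatrix D) (projPsd_sub_posSemidef X)
    have h4 := trace_conj_nonneg (B := toMatrix D) hE
    have h5 : ((toMatrix D).transpose * toMatrix E * toMatrix D).trace = 0 := by
      nlinarith
    have h6 : M * toMatrix D = 0 := mul_eq_zero_of_trace_conj_eq_zero hE h5
    have h7 : (toMatrix Y + M) * toMatrix D = 0 := by rw [Matrix.add_mul, hYD, h6, add_zero]
    exact toMatrix_injective (by rw [map_zero]; exact hunit.mul_right_eq_zero.1 h7)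
  -- Elements of the B-subdifferentials at `X - ε E` accumulate, as `ε → 0`, at an element of the
  -- B-subdifferential at `X`.
  let ε : ℕ → ℝ := fun k => 1 / ((k : ℝ) + 1)
  have hε : ∀ k, 0 < ε k := fun k => by positivity
  choose V hV using fun k => nonempty_bSubdifferential lipschitzWith_projPsd (X - ε k • E)
  have : ProperSpace (SymMat n →L[ℝ] SymMat n) := FiniteDimensional.proper ℝ _
  obtain ⟨U, -, φ, hφ, hVU⟩ :=
    (isCompact_closedBall (0 : SymMat n →L[ℝ] SymMat n) 1).tendsto_subseq (x := V) fun k => by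
      simpa using norm_le_of_mem_bSubdifferential lipschitzWith_projPsd (hV k)
  refine ⟨U, mem_bSubdifferential_of_tendsto (fun k => hV (φ k)) ?_ hVU, fun H hH => ?_⟩
  · have h0 : Tendsto ε atTop (𝓝 0) := tendsto_one_div_add_atTop_nhds_zero_nat
    have h1 : Tendsto (fun k => X - ε k • E) atTop (𝓝 X) := by
      simpa using (h0.smul_const E).const_sub X
    exact h1.comp hφ.tendsto_atTop
  · have h1 : Tendsto (fun k => V (φ k) H) atTop (𝓝 (U H)) :=
      ((ContinuousLinearMap.apply ℝ (SymMat n) H).continuous.tendsto U).comp hVU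
    refine tendsto_nhds_unique h1 ?_
    simp only [hkill _ (hε _) _ (hV _) H hH, tendsto_const_nhds]

end PsdProjector

/-! ### The tangent cone and constraint nondegeneracy -/

section Tangent

variable {n m : ℕ}

open SymMat

/-- A positive semidefinite `B` with `Y B = 0` is a supporting functional of `𝒮ⁿ₊` at `Y`, hence
nonnegative on the tangent cone. -/
theorem inner_nonneg_of_mem_posTangentConeAt {Y B H : SymMat n}
    (hB : (toMatrix B).PosSemidef) (hYB : toMatrix Y * toMatrix B = 0)
    (hH : H ∈ posTangentConeAt (psdCone n) Y) : 0 ≤ inner ℝ B H := by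
  have hmin : IsLocalMinOn (innerSL ℝ B) (psdCone n) Y := by
    refine Filter.eventually_of_mem self_mem_nhdsWithin fun W hW => ?_
    have h1 : inner ℝ B Y = 0 := by rw [real_inner_comm, inner_def, hYB, Matrix.trace_zero]
    rw [innerSL_apply_apply, innerSL_apply_apply, h1]
    exact trace_mul_nonneg hB hW
  exact hmin.hasFDerivWithinAt_nonneg (innerSL ℝ B).hasFDerivWithinAt hH

/-- Symmetric matrices `M` with `Y M = 0` are orthogonal to the lineality space of the tangent cone
of `𝒮ⁿ₊` at `Y`. -/
theorem inner_eq_zero_of_mem_linealitySpace {Y M H : SymMat n}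
    (hYM : toMatrix Y * toMatrix M = 0)
    (hH : H ∈ linealitySpace (posTangentConeAt (psdCone n) Y)) : inner ℝ M H = 0 := by
  have key : ∀ B : SymMat n, (toMatrix B).PosSemidef → toMatrix Y * toMatrix B = 0 →
      inner ℝ B H = 0 := by
    intro B hB hYB
    have h1 := inner_nonneg_of_mem_posTangentConeAt hB hYB hH.1
    have h2 := inner_nonneg_of_mem_posTangentConeAt hB hYB hH.2
    rw [inner_neg_right] at h2
    linarith
  -- The positive and negative parts of `M` are annihilated by `Y` as well.
  set P := projPsd n M with hP
  have hPP : toMatrix Y * toMatrix P = 0 := by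
    have h1 : toMatrix Y * (toMatrix P * toMatrix P) = 0 := by
      have h2 := projPsd_mul_sub M
      rw [← hP, SymMat.mul_eq_zero_comm, map_sub, Matrix.sub_mul, sub_eq_zero] at h2
      rw [← h2, ← Matrix.mul_assoc, hYM, Matrix.zero_mul]
    have h3 : ((toMatrix P * toMatrix Y).transpose * (toMatrix P * toMatrix Y)).trace = 0 := by
      rw [Matrix.transpose_mul, transpose_toMatrix, transpose_toMatrix, ← Matrix.mul_assoc,
        Matrix.mul_assoc (toMatrix Y), h1, Matrix.zero_mul, Matrix.trace_zero]
    exact SymMat.mul_eq_zero_comm.1 (eq_zero_of_transpose_mul_self_trace h3)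
  have h1 := key P (projPsd_posSemidef M) hPP
  have h2 := key (P - M) (projPsd_sub_posSemidef M) (by
    rw [map_sub, Matrix.mul_sub, hPP, hYM, sub_zero])
  rw [inner_sub_left] at h2
  linarith

/-- The Lyapunov operator `B ↦ Y B + B Y`. -/
noncomputable def lyapunov (Y : SymMat n) : SymMat n →ₗ[ℝ] SymMat n where
  toFun B := SymMat.ofIsSymm (toMatrix Y * toMatrix B + toMatrix B * toMatrix Y) (by
    rw [Matrix.IsSymm, Matrix.transpose_add, Matrix.transpose_mul, Matrix.transpose_mul,
      transpose_toMatrix, transpose_toMatrix, add_comm])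
  map_add' B B' := toMatrix_injective (by
    simp only [map_add, toMatrix_ofIsSymm, Matrix.mul_add, Matrix.add_mul]; abel)
  map_smul' c B := toMatrix_injective (by simp)

theorem toMatrix_lyapunov (Y B : SymMat n) :
    toMatrix (lyapunov Y B) = toMatrix Y * toMatrix B + toMatrix B * toMatrix Y := rfl

theorem inner_lyapunov (Y B M : SymMat n) :
    inner ℝ (lyapunov Y B) M = inner ℝ B (lyapunov Y M) := by
  rw [inner_def, inner_def, toMatrix_lyapunov, toMatrix_lyapunov, Matrix.add_mul, Matrix.mul_add,
    Matrix.trace_add, Matrix.trace_add, add_comm, Matrix.mul_assoc, Matrix.mul_assoc,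
    Matrix.trace_mul_comm (toMatrix Y), Matrix.mul_assoc]

theorem mul_eq_zero_of_lyapunov_eq_zero {Y M : SymMat n} (hY : (toMatrix Y).PosSemidef)
    (h : lyapunov Y M = 0) : toMatrix Y * toMatrix M = 0 := by
  refine mul_eq_zero_of_trace_conj_eq_zero hY ?_
  have h1 : inner ℝ M (lyapunov Y M) = 0 := by rw [h, inner_zero_right]
  rw [inner_def, toMatrix_lyapunov, Matrix.mul_add, Matrix.trace_add,
    ← Matrix.mul_assoc, ← Matrix.mul_assoc,
    Matrix.trace_mul_comm (toMatrix M * toMatrix M), ← Matrix.mul_assoc,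
    Matrix.trace_mul_comm (toMatrix Y * toMatrix M), ← Matrix.mul_assoc] at h1
  rw [transpose_toMatrix]
  linarith

/-- `Y B + B Y` is tangent to `𝒮ⁿ₊` at `Y`, as the velocity of the curve
`t ↦ (1 + t B) Y (1 + t B)`. -/
theorem lyapunov_mem_posTangentConeAt {Y : SymMat n} (hY : (toMatrix Y).PosSemidef)
    (B : SymMat n) : lyapunov Y B ∈ posTangentConeAt (psdCone n) Y := by
  let K : SymMat n := SymMat.ofIsSymm (toMatrix B * toMatrix Y * toMatrix B) (by
    simp [Matrix.IsSymm, Matrix.transpose_mul, Matrix.mul_assoc])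
  have hK : toMatrix K = toMatrix B * toMatrix Y * toMatrix B := rfl
  have hlim : Tendsto (fun t : NNReal => (t : ℝ)) (𝓝[>] 0) (𝓝 0) :=
    (NNReal.continuous_coe.tendsto 0).mono_left nhdsWithin_le_nhds
  refine mem_tangentConeAt_of_seq (𝓝[>] (0 : NNReal)) (fun t => t⁻¹)
    (fun t => (t : ℝ) • lyapunov Y B + (t : ℝ) ^ 2 • K) ?_ ?_ ?_
  · simpa using (hlim.smul_const (lyapunov Y B)).add ((hlim.pow 2).smul_const K)
  · refine Eventually.of_forall fun t => ?_
    have h := hY.conjTranspose_mul_mul_same (1 + (t : ℝ) • toMatrix B)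
    have heq : toMatrix (Y + ((t : ℝ) • lyapunov Y B + (t : ℝ) ^ 2 • K)) =
        (1 + (t : ℝ) • toMatrix B).conjTranspose * toMatrix Y * (1 + (t : ℝ) • toMatrix B) := by
      rw [Matrix.conjTranspose_eq_transpose_of_trivial, Matrix.transpose_add,
        Matrix.transpose_smul, Matrix.transpose_one, transpose_toMatrix]
      simp only [map_add, map_smul, toMatrix_lyapunov, hK, Matrix.add_mul, Matrix.mul_add,
        Matrix.smul_mul, Matrix.mul_smul, Matrix.one_mul, Matrix.mul_one, smul_smul, smul_add, sq]
      abel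
    change (toMatrix _).PosSemidef
    rw [heq]
    exact h
  · have h : Tendsto (fun t : NNReal => lyapunov Y B + (t : ℝ) • K) (𝓝[>] 0)
        (𝓝 (lyapunov Y B)) := by
      simpa using (hlim.smul_const K).const_add (lyapunov Y B)
    refine h.congr' (eventually_nhdsWithin_of_forall fun t ht => ?_)
    have ht' : (t : ℝ) ≠ 0 := NNReal.coe_ne_zero.2 (ne_of_gt ht)
    beta_reduce
    rw [NNReal.smul_def, NNReal.coe_inv, smul_add, smul_smul, smul_smul, inv_mul_cancel₀ ht',
      one_smul, sq, inv_mul_cancel_left₀ ht']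

/-- Constraint nondegeneracy at `Y` in dual form: only `y = 0` satisfies `Y (A* y) = 0`. -/
theorem image_linealitySpace_eq_univ_iff (A : SymMat n →L[ℝ] EuclideanSpace ℝ (Fin m))
    {Y : SymMat n} (hY : (toMatrix Y).PosSemidef) :
    A '' linealitySpace (posTangentConeAt (psdCone n) Y) = Set.univ ↔
      ∀ y, toMatrix Y * toMatrix (A.adjoint y) = 0 → y = 0 := by
  constructor
  · intro h y hy
    obtain ⟨H, hH, hHy⟩ : y ∈ A '' linealitySpace (posTangentConeAt (psdCone n) Y) :=
      h ▸ Set.mem_univ y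
    have h1 := inner_eq_zero_of_mem_linealitySpace hy hH
    rwa [A.adjoint_inner_left, hHy, inner_self_eq_zero] at h1
  · intro h
    -- The adjoint of `A ∘ lyapunov Y` is injective, so that this map is onto.
    have horth : (A.toLinearMap ∘ₗ lyapunov Y).rangeᗮ = ⊥ := by
      rw [Submodule.eq_bot_iff]
      intro y hy
      refine h y (mul_eq_zero_of_lyapunov_eq_zero hY (ext_inner_left ℝ fun B => ?_))
      have h1 := (Submodule.mem_orthogonal _ _).1 hy _ ⟨B, rfl⟩
      rw [inner_zero_right, ← inner_lyapunov, A.adjoint_inner_right]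
      exact h1
    rw [Submodule.orthogonal_eq_bot_iff, LinearMap.range_eq_top] at horth
    refine Set.eq_univ_of_forall fun y => ?_
    obtain ⟨B, hB⟩ := horth y
    refine ⟨lyapunov Y B, ⟨lyapunov_mem_posTangentConeAt hY B, ?_⟩, hB⟩
    rw [← map_neg]
    exact lyapunov_mem_posTangentConeAt hY (-B)

end Tangent

/-! ### The quadratic form of the generalized Hessian -/

section Hessian

variable {n m : ℕ} {Q : SymMat n →L[ℝ] SymMat n} {A : SymMat n →L[ℝ] EuclideanSpace ℝ (Fin m)}

/-- `[Q; -A]` is the adjoint of `[Q, -A*]`. -/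
theorem inner_colOp (hQ : Q.IsPositive) (d : VarSpace m Q) (H : SymMat n) :
    inner ℝ d (colOp Q A H) = inner ℝ (rowOp Q A d) H := by
  rw [WithLp.prod_inner_apply]
  change inner ℝ (d.fst : SymMat n) (Q H) + inner ℝ d.snd (-A H) =
    inner ℝ (Q d.fst - A.adjoint d.snd) H
  rw [inner_sub_left, A.adjoint_inner_left, inner_neg_right,
    hQ.inner_left_eq_inner_right, sub_eq_add_neg]

theorem inner_diagOp (d e : VarSpace m Q) :
    inner ℝ d (diagOp m Q e) = inner ℝ (d.fst : SymMat n) (Q e.fst) := by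
  rw [WithLp.prod_inner_apply]
  change inner ℝ (d.fst : SymMat n) (Q e.fst) + inner ℝ d.snd 0 = _
  rw [inner_zero_right, add_zero]

theorem inner_hessOp (hQ : Q.IsPositive) (σ : ℝ) (U : SymMat n →L[ℝ] SymMat n)
    (d e : VarSpace m Q) :
    inner ℝ d (hessOp Q A σ U e) =
      inner ℝ (d.fst : SymMat n) (Q e.fst) + σ * inner ℝ (rowOp Q A d) (U (rowOp Q A e)) := by
  rw [hessOp, LinearMap.add_apply, LinearMap.smul_apply, inner_add_right, inner_diagOp,
    real_inner_smul_right, LinearMap.comp_apply, inner_colOp hQ]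
  rfl

theorem isSymmetric_hessOp (hQ : Q.IsPositive) (σ : ℝ) {U : SymMat n →L[ℝ] SymMat n}
    (hU : ∀ H K, inner ℝ (U H) K = inner ℝ H (U K)) : (hessOp Q A σ U).IsSymmetric := by
  intro d e
  rw [real_inner_comm, inner_hessOp hQ, inner_hessOp hQ, ← hQ.inner_left_eq_inner_right,
    real_inner_comm, ← hU, real_inner_comm (rowOp Q A d)]

/-- A positive semidefinite operator is positive definite on its range. -/
theorem eq_zero_of_mem_range_of_inner_eq_zero (hQ : Q.IsPositive) {W : SymMat n}
    (hW : W ∈ Q.toLinearMap.range) (h : inner ℝ W (Q W) = 0) : W = 0 := by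
  have hQW : Q W = 0 := by
    have hquad : ∀ t : ℝ, 0 ≤ inner ℝ (Q W) (Q (Q W)) * (t * t) + 2 * ‖Q W‖ ^ 2 * t + 0 := by
      intro t
      have h1 := hQ.inner_nonneg_right (W + t • Q W)
      have h2 : inner ℝ W (Q (Q W)) = ‖Q W‖ ^ 2 := by
        rw [← hQ.inner_left_eq_inner_right, real_inner_self_eq_norm_sq]
      simp only [map_add, map_smul, inner_add_left, inner_add_right, real_inner_smul_left,
        real_inner_smul_right, h, h2, real_inner_self_eq_norm_sq] at h1
      linarith
    have h3 := discrim_le_zero hquad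
    rw [discrim, mul_zero, sub_zero] at h3
    have h4 : 2 * ‖Q W‖ ^ 2 = 0 := pow_eq_zero_iff two_ne_zero |>.1 (le_antisymm h3 (sq_nonneg _))
    simpa using h4
  obtain ⟨V, rfl⟩ := hW
  rw [← inner_self_eq_zero (𝕜 := ℝ)]
  change inner ℝ (Q V) (Q V) = 0
  rw [hQ.inner_left_eq_inner_right]
  exact hQW ▸ inner_zero_right V

end Hessian

end QSDP

theorem mainTheorem4 {n m : ℕ}
    (Q : QSDP.SymMat n →L[ℝ] QSDP.SymMat n) (hQ : Q.IsPositive)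
    (A : QSDP.SymMat n →L[ℝ] EuclideanSpace ℝ (Fin m))
    (b : EuclideanSpace ℝ (Fin m)) (C Xhat : QSDP.SymMat n) (σ : ℝ) (hσ : 0 < σ)
    (Chat : QSDP.SymMat n) (hChat : Chat = C - σ⁻¹ • Xhat)
    (z : QSDP.VarSpace m Q)
    (hz : IsMinOn (QSDP.phi Q A b Chat σ) Set.univ z)
    (Y : QSDP.SymMat n) (hY : Y = QSDP.projPsd n (QSDP.slack Q A Chat z)) :
    (A '' QSDP.linealitySpace (posTangentConeAt (QSDP.psdCone n) Y) = Set.univ) ↔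
      ∀ V ∈ QSDP.genHessian Q A Chat σ z,
        V.IsSymmetric ∧ ∀ d : QSDP.VarSpace m Q, d ≠ 0 → 0 < inner ℝ d (V d) := by
  subst hY
  rw [QSDP.image_linealitySpace_eq_univ_iff A (QSDP.projPsd_posSemidef _)]
  constructor
  · rintro h _ ⟨U, hU, rfl⟩
    obtain ⟨hsymm, hnonneg, hker⟩ := QSDP.clarkeSubdifferential_projPsd hU
    refine ⟨QSDP.isSymmetric_hessOp hQ σ hsymm, fun d hd => ?_⟩
    have h1 := hQ.inner_nonneg_right (d.fst : QSDP.SymMat n)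
    have h2 := mul_nonneg hσ.le (hnonneg (QSDP.rowOp Q A d))
    rw [QSDP.inner_hessOp hQ]
    refine (add_nonneg h1 h2).lt_of_ne' fun h0 => hd ?_
    have hW : (d.fst : QSDP.SymMat n) = 0 :=
      QSDP.eq_zero_of_mem_range_of_inner_eq_zero hQ d.fst.2 (by linarith)
    have hU0 := hker (QSDP.rowOp Q A d)
      ((mul_eq_zero.1 (by linarith : σ * _ = 0)).resolve_left hσ.ne')
    have hrow : QSDP.rowOp Q A d = -A.adjoint d.snd := by
      change Q d.fst - A.adjoint d.snd = _
      rw [hW, map_zero, zero_sub]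
    rw [hrow, map_neg, Matrix.mul_neg, neg_eq_zero] at hU0
    apply (WithLp.equiv 2 _).injective
    exact Prod.ext (Subtype.ext hW) (h _ hU0)
  -- Only directions `(0, y)` can be degenerate, and there the quadratic form of the operator given
  -- by `U` is `σ ⟨A* y, U A* y⟩`.
  · intro h y hy
    obtain ⟨U, hU, hUker⟩ := QSDP.exists_mem_bSubdifferential_projPsd (QSDP.slack Q A Chat z)
    by_contra hy0
    let d : QSDP.VarSpace m Q := WithLp.toLp 2 (0, y)
    have hd : d ≠ 0 := fun hd => hy0 (congrArg (fun d : QSDP.VarSpace m Q => d.snd) hd)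
    have hpos := (h _ ⟨U, subset_convexHull ℝ _ hU, rfl⟩).2 d hd
    have hrow : QSDP.rowOp Q A d = -A.adjoint y := by
      change Q (0 : QSDP.SymMat n) - A.adjoint y = _
      rw [map_zero, zero_sub]
    have hfst : (d.fst : QSDP.SymMat n) = 0 := rfl
    rw [QSDP.inner_hessOp hQ, hrow, hfst, map_neg, hUker _ hy] at hpos
    simp at hpos
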